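/- There is an absolute constant $D$ such that the following holds. Let $k\ge 1$ be an integer, let $A\subseteq \mathbb{Z}_k=\mathbb{Z}/k\mathbb{Z}$ be a set of size $n$, and suppose that every prime factor of $k$ is larger than $n^n$. Let $\ell$ be an integer with $2\le \ell\le n$, let $Y_1,\dots,Y_\ell$ be independent random variables, each uniformly distributed on $A$, and put $Y=Y_1+\dots+Y_\ell$. Then, for every $x\in\mathbb{Z}_k$, $$\mathbb{P}[Y=x]\le \frac{D}{n\sqrt{\ell-1}}.$$ -/

import Mathlib

open MeasureTheory ProbabilityTheory

/-! The claim is a count of tuples in `A` with prescribed sum. Fixing all but `m = l / 2` summands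
costs nothing, and `2 * m ≤ n` permits rectification: by Dirichlet's argument a unit multiple of `A`
lifts to integers so small that `m`-fold sums do not wrap around. The set then moves to `ZMod q` for
a large prime `q` (`exists_sumCount_le_prime`).

There the count is at most the average of `‖expSum‖ ^ m`. With `ψ = ‖expSum‖ / n` one has `ψ² = 1 -
d²` for a subadditive `d` (`charDist`, rescaled). Parseval bounds `{d ≤ 1/2}` by `O(q / n)`, and
Cauchy–Davenport then forces `{d ≤ r}` to have at most `1 + O(r * q / n)` elements. Since `ψ ^ m ≤
exp (-m * d² / 2)`, summing over levels gives `1 + O(q / (n * √m))`; the `1`, from frequency zero,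
is negligible for large `q`. -/

/-! ### Counting representations as sums -/

/-- The number of `m`-tuples of elements of `A` with sum `x`. -/
def sumCount {G : Type*} [AddCommMonoid G] [DecidableEq G] (A : Finset G) (m : ℕ) (x : G) : ℕ :=
  ((Fintype.piFinset fun _ : Fin m => A).filter fun f => ∑ i, f i = x).card

lemma sumCount_succ_le {G : Type*} [AddCommGroup G] [DecidableEq G] (A : Finset G) (m : ℕ)
    (x : G) : sumCount A (m + 1) x ≤ ∑ a ∈ A, sumCount A m (x - a) := by
  unfold sumCount
  rw [Finset.card_eq_sum_card_fiberwise (f := fun f => f 0) (t := A)]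
  · refine Finset.sum_le_sum fun a _ => ?_
    refine Finset.card_le_card_of_injOn Fin.tail ?_ ?_
    · intro f hf
      simp only [Finset.coe_filter, Finset.mem_filter, Fintype.mem_piFinset, Set.mem_ofPred_eq]
        at hf ⊢
      obtain ⟨⟨hA, hx⟩, ha⟩ := hf
      refine ⟨fun i => hA i.succ, ?_⟩
      rw [Fin.sum_univ_succ, ha] at hx
      exact eq_sub_of_add_eq' hx
    · intro f hf g hg h
      simp only [Finset.coe_filter, Finset.mem_filter, Set.mem_ofPred_eq] at hf hg
      rw [← Fin.cons_self_tail f, ← Fin.cons_self_tail g, h, hf.2, hg.2]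
  · intro f hf
    simp only [Finset.coe_filter, Fintype.mem_piFinset, Set.mem_ofPred_eq] at hf
    exact hf.1 0

lemma sumCount_add_le {G : Type*} [AddCommGroup G] [DecidableEq G] (A : Finset G) (m : ℕ)
    {c : ℝ} (hc : ∀ x, (sumCount A m x : ℝ) ≤ c) (j : ℕ) (x : G) :
    (sumCount A (m + j) x : ℝ) ≤ (A.card : ℝ) ^ j * c := by
  induction j generalizing x with
  | zero => simpa using hc x
  | succ j ih =>
    calc (sumCount A (m + j + 1) x : ℝ) ≤ ∑ a ∈ A, (sumCount A (m + j) (x - a) : ℝ) := by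
          exact_mod_cast sumCount_succ_le A (m + j) x
      _ ≤ ∑ a ∈ A, (A.card : ℝ) ^ j * c := Finset.sum_le_sum fun a _ => ih _
      _ = _ := by rw [Finset.sum_const, nsmul_eq_mul]; ring

lemma sumCount_one_le {G : Type*} [AddCommGroup G] [DecidableEq G] (A : Finset G) (x : G) :
    sumCount A 1 x ≤ 1 := by
  refine Finset.card_le_one.mpr fun f hf g hg => ?_
  simp only [Finset.mem_filter, Fin.sum_univ_one] at hf hg
  funext i
  rw [Subsingleton.elim i 0, hf.2, hg.2]

lemma sumCount_le_of_freiman {G H : Type*} [AddCommMonoid G] [DecidableEq G] [AddCommMonoid H]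
    [DecidableEq H] (A : Finset G) (m : ℕ) (b : G → H) (hb : Set.InjOn b A)
    (hsum : ∀ f g : Fin m → G, (∀ i, f i ∈ A) → (∀ i, g i ∈ A) → ∑ i, f i = ∑ i, g i →
      ∑ i, b (f i) = ∑ i, b (g i)) (x : G) :
    ∃ y, sumCount A m x ≤ sumCount (A.image b) m y := by
  by_cases h : ∃ f : Fin m → G, (∀ i, f i ∈ A) ∧ ∑ i, f i = x
  · obtain ⟨g, hg, hx⟩ := h
    refine ⟨∑ i, b (g i), Finset.card_le_card_of_injOn (fun f i => b (f i)) ?_ ?_⟩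
    · intro f hf
      simp only [Finset.coe_filter, Fintype.mem_piFinset, Set.mem_ofPred_eq] at hf ⊢
      exact ⟨fun i => Finset.mem_image_of_mem _ (hf.1 i),
        hsum f g hf.1 hg (hf.2.trans hx.symm)⟩
    · intro f hf g hg h
      simp only [Finset.coe_filter, Fintype.mem_piFinset, Set.mem_ofPred_eq] at hf hg
      funext i
      exact hb (hf.1 i) (hg.1 i) (congrFun h i)
  -- No representation of `x` exists, so any target works.
  · refine ⟨0, ?_⟩
    have : sumCount A m x = 0 := by
      refine Finset.card_eq_zero.mpr (Finset.filter_eq_empty_iff.mpr fun f hf hx => h ⟨f, ?_, hx⟩)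
      simpa using hf
    omega

/-! ### Rectification: from `ZMod k` to a prime modulus -/

/-- Simultaneous Dirichlet approximation by a unit of `ZMod k`. -/
lemma exists_unit_mul_small_lift (k n : ℕ) (hk : 1 < k) (A : Finset (ZMod k)) (hA : A.card = n)
    (hn : 0 < n) (hp : n ^ n < k.minFac) :
    ∃ (u : ZMod k) (b : ZMod k → ℤ), IsUnit u ∧ ∀ a ∈ A, (b a : ZMod k) = u * a ∧
      (n : ℤ) * |b a| < k := by
  classical
  have : NeZero k := ⟨by omega⟩
  -- Pigeonhole: `n ^ n` boxes of side `k / n`, and `k.minFac` multipliers `t`. A difference of two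
  -- multipliers is below `k.minFac`, hence a unit.
  have hmem : ∀ t ∈ Finset.range k.minFac, (fun a : A => n * ((t : ZMod k) * a).val / k) ∈
      Fintype.piFinset fun _ : A => Finset.range n := by
    intro t _
    simp only [Fintype.mem_piFinset, Finset.mem_range]
    intro a
    rw [Nat.div_lt_iff_lt_mul (by omega)]
    exact Nat.mul_lt_mul_of_pos_left (ZMod.val_lt _) hn
  have hcard : (Fintype.piFinset fun _ : A => Finset.range n).card <
      (Finset.range k.minFac).card := by
    simpa [hA] using hp
  obtain ⟨s, hs, t, ht, hne, heq⟩ := Finset.exists_ne_map_eq_of_card_lt_of_maps_to hcard hmem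
  wlog hst : s < t generalizing s t
  · exact this t ht s hs hne.symm heq.symm (by omega)
  simp only [Finset.mem_range] at hs ht
  refine ⟨((t - s : ℕ) : ZMod k), fun a => ((t : ZMod k) * a).val - ((s : ZMod k) * a).val, ?_, ?_⟩
  · rw [ZMod.isUnit_iff_coprime]
    refine Nat.Coprime.symm ?_
    by_contra h
    have h1 : Nat.gcd k (t - s) ≠ 1 := h
    have h2 := Nat.minFac_le_of_dvd (n := k) (m := Nat.gcd k (t - s))
      (by have := Nat.gcd_pos_of_pos_left (t - s) (show 0 < k by omega); omega)
      (Nat.gcd_dvd_left _ _)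
    have h3 := Nat.le_of_dvd (by omega) (Nat.gcd_dvd_right k (t - s))
    omega
  · intro a ha
    constructor
    · push_cast [Nat.cast_sub hst.le]
      simp only [ZMod.natCast_val, ZMod.cast_id', id_eq]
      ring
    · have h := congrFun heq ⟨a, ha⟩
      simp only at h
      set v := ((t : ZMod k) * a).val
      set w := ((s : ZMod k) * a).val
      have h1 := Nat.div_add_mod (n * v) k
      have h2 := Nat.div_add_mod (n * w) k
      have h3 := Nat.mod_lt (n * v) (show 0 < k by omega)
      have h4 := Nat.mod_lt (n * w) (show 0 < k by omega)
      rw [h] at h2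
      have e : (n : ℤ) * |(v : ℤ) - w| = |((n * v : ℕ) : ℤ) - ((n * w : ℕ) : ℤ)| := by
        push_cast
        rw [← mul_sub, abs_mul, Nat.abs_cast]
      rw [e, abs_lt]
      constructor <;> omega

/-- Sums of `m` lifts are below `m * k / n ≤ k / 2` in absolute value, so congruent sums mod `k` are
equal integers and stay equal mod `q`. The bound `2 * k ≤ q` keeps the lifts distinct. -/
lemma exists_sumCount_le_prime (k n m : ℕ) (hk : 1 < k) (A : Finset (ZMod k)) (hA : A.card = n)
    (hm : 1 ≤ m) (hmn : 2 * m ≤ n) (hp : n ^ n < k.minFac) (q : ℕ) (hq : 2 * k ≤ q)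
    (x : ZMod k) :
    ∃ (B : Finset (ZMod q)) (y : ZMod q), B.card = n ∧ sumCount A m x ≤ sumCount B m y := by
  obtain ⟨u, b, hu, hb⟩ := exists_unit_mul_small_lift k n hk A hA (by omega) hp
  have hbk : ∀ a ∈ A, 2 * |b a| < k := fun a ha => by
    have := (hb a ha).2
    have h2 : (2 : ℤ) ≤ n := by omega
    nlinarith [abs_nonneg (b a)]
  have hinj : Set.InjOn (fun a => ((b a : ℤ) : ZMod q)) A := by
    intro a ha c hc h
    have h' : ((b a : ℤ) : ZMod q) = b c := h
    rw [ZMod.intCast_eq_intCast_iff_dvd_sub] at h'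
    have e : b c - b a = 0 := by
      refine Int.eq_zero_of_abs_lt_dvd h' ?_
      have := abs_sub (b c) (b a)
      have := hbk a ha
      have := hbk c hc
      have : (2 * k : ℤ) ≤ q := by exact_mod_cast hq
      omega
    have e2 : b a = b c := by omega
    have e3 : u * a = u * c := by rw [← (hb a ha).1, ← (hb c hc).1, e2]
    exact hu.mul_left_cancel e3
  obtain ⟨y, hy⟩ := sumCount_le_of_freiman A m (fun a => ((b a : ℤ) : ZMod q)) hinj (by
    intro f g hf hg h
    rw [← Int.cast_sum, ← Int.cast_sum]
    congr 1
    have hcast : ∀ f : Fin m → ZMod k, (∀ i, f i ∈ A) →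
        ((∑ i, b (f i) : ℤ) : ZMod k) = u * ∑ i, f i := by
      intro f hf
      rw [Int.cast_sum, Finset.mul_sum]
      exact Finset.sum_congr rfl fun i _ => (hb _ (hf i)).1
    have habs : ∀ f : Fin m → ZMod k, (∀ i, f i ∈ A) → (n : ℤ) * |∑ i, b (f i)| < m * k := by
      intro f hf
      have : Nonempty (Fin m) := ⟨⟨0, hm⟩⟩
      calc (n : ℤ) * |∑ i, b (f i)| ≤ n * ∑ i, |b (f i)| := by
            gcongr; exact Finset.abs_sum_le_sum_abs _ _
        _ = ∑ i, (n : ℤ) * |b (f i)| := Finset.mul_sum _ _ _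
        _ < ∑ _i : Fin m, (k : ℤ) :=
            Finset.sum_lt_sum_of_nonempty Finset.univ_nonempty fun i _ => (hb _ (hf i)).2
        _ = m * k := by simp
    have hd : (k : ℤ) ∣ ∑ i, b (f i) - ∑ i, b (g i) := by
      rw [← ZMod.intCast_eq_intCast_iff_dvd_sub, hcast g hg, hcast f hf, h]
    refine sub_eq_zero.mp (Int.eq_zero_of_abs_lt_dvd hd ?_)
    have h1 := habs f hf
    have h2 := habs g hg
    have h3 := abs_sub (∑ i, b (f i)) (∑ i, b (g i))
    have h4 : (2 * m : ℤ) ≤ n := by exact_mod_cast hmn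
    have h5 : (n : ℤ) * |∑ i, b (f i) - ∑ i, b (g i)| < n * k := by nlinarith
    exact lt_of_mul_lt_mul_left h5 (by positivity)) x
  exact ⟨_, y, by rw [Finset.card_image_of_injOn hinj, hA], hy⟩

/-! ### From probability to counting -/

lemma measureReal_sum_eq_le_sumCount {k : ℕ} [NeZero k] (A : Finset (ZMod k)) (l : ℕ)
    {Ω : Type*} [MeasurableSpace Ω] (P : Measure Ω) [IsProbabilityMeasure P]
    (Y : Fin l → Ω → ZMod k) (hY : ∀ i, HasLaw (Y i) (uniformOn (A : Set (ZMod k))) P)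
    (hI : iIndepFun Y P) (x : ZMod k) :
    P.real {ω | ∑ i, Y i ω = x} ≤ sumCount A l x / (A.card : ℝ) ^ l := by
  classical
  have hone : ∀ i a, P.real {ω | Y i ω = a} = if a ∈ A then (A.card : ℝ)⁻¹ else 0 := by
    intro i a
    rw [measureReal_def, (hY i).measure_eq (p := fun y => y = a) (by measurability)]
    have := uniformOn_apply_finset (s := A) (t := {a})
    simp only [Finset.coe_singleton] at this
    rw [Set.ofPred_eq_eq_singleton, this]
    split_ifs with h
    · simp [Finset.inter_singleton_of_mem h]
    · simp [Finset.inter_singleton_of_notMem h]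
  have hpt : ∀ f : Fin l → ZMod k, P.real (⋂ i, {ω | Y i ω = f i}) =
      ∏ i, (if f i ∈ A then (A.card : ℝ)⁻¹ else 0) := by
    intro f
    have := hI.measure_inter_preimage_eq_mul Finset.univ (sets := fun i => {f i})
      (fun i _ => by measurability)
    simp only [Finset.mem_univ, Set.iInter_true] at this
    rw [← Finset.prod_congr rfl fun i _ => hone i (f i)]
    simp only [measureReal_def]
    rw [← ENNReal.toReal_prod]
    exact congrArg _ this
  calc P.real {ω | ∑ i, Y i ω = x}
      ≤ P.real (⋃ f ∈ Finset.univ.filter (fun f : Fin l → ZMod k => ∑ i, f i = x),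
          ⋂ i, {ω | Y i ω = f i}) := by
        refine measureReal_mono (fun ω hω => ?_) (measure_ne_top _ _)
        simp only [Set.mem_iUnion, Set.mem_iInter]
        exact ⟨fun i => Y i ω, by simpa using hω, fun i => rfl⟩
    _ ≤ ∑ f ∈ Finset.univ.filter (fun f : Fin l → ZMod k => ∑ i, f i = x),
          P.real (⋂ i, {ω | Y i ω = f i}) := measureReal_biUnion_finset_le _ _
    _ ≤ ∑ f ∈ Finset.univ.filter (fun f : Fin l → ZMod k => ∑ i, f i = x),
          if (∀ i, f i ∈ A) then ((A.card : ℝ)⁻¹) ^ l else 0 := by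
        refine Finset.sum_le_sum fun f _ => ?_
        rw [hpt]
        split_ifs with h
        · simp [h]
        · push Not at h
          obtain ⟨i, hi⟩ := h
          exact (Finset.prod_eq_zero (Finset.mem_univ i) (by simp [hi])).le
    _ = sumCount A l x / (A.card : ℝ) ^ l := by
        rw [← Finset.sum_filter, Finset.sum_const, nsmul_eq_mul, inv_pow, div_eq_mul_inv,
          sumCount, Finset.filter_filter]
        congr 3
        ext f
        simp [and_comm]

/-! ### Level sets of subadditive functions -/

open scoped Pointwise in
lemma ZMod.card_level_mul {q : ℕ} [Fact q.Prime] (d : ZMod q → ℝ) (h0 : d 0 = 0)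
    (hadd : ∀ x y, d (x + y) ≤ d x + d y) {r : ℝ} (hr : 0 ≤ r) (m : ℕ) :
    min q (m * ((Finset.univ.filter fun x => d x ≤ r).card - 1) + 1) ≤
      (Finset.univ.filter fun x => d x ≤ m * r).card := by
  classical
  have hne : ∀ s : ℝ, 0 ≤ s → (Finset.univ.filter fun x => d x ≤ s).Nonempty :=
    fun s hs => ⟨0, by simp [h0, hs]⟩
  induction m with
  | zero =>
    have := (hne _ (show 0 ≤ ((0 : ℕ) : ℝ) * r by simp)).card_pos
    omega
  | succ m ih =>
    have hc := ZMod.cauchy_davenport (Fact.out : q.Prime) (hne (m * r) (by positivity)) (hne r hr)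
    have hsub : ((Finset.univ.filter fun x => d x ≤ m * r) +
        (Finset.univ.filter fun x => d x ≤ r)) ⊆
        (Finset.univ.filter fun x => d x ≤ (m + 1 : ℕ) * r) := by
      intro z hz
      obtain ⟨x, hx, y, hy, rfl⟩ := Finset.mem_add.mp hz
      simp only [Finset.mem_filter, Finset.mem_univ, true_and] at hx hy ⊢
      push_cast
      linarith [hadd x y]
    have h1 := Finset.card_le_card hsub
    have h2 := (hne r hr).card_pos
    have h3 := (hne (m * r) (by positivity)).card_pos
    rw [add_mul, one_mul]
    omega

/-- The `m`-fold sumset of `{d ≤ r}`, `m = ⌊1 / (2 * r)⌋₊`, stays inside `{d ≤ 1/2}`. As `K < q`,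
the latter is not the whole group, so Cauchy–Davenport growth never saturates. -/
lemma ZMod.card_level_le {q : ℕ} [Fact q.Prime] (d : ZMod q → ℝ) (h0 : d 0 = 0)
    (hadd : ∀ x y, d (x + y) ≤ d x + d y) {K : ℝ} (hKq : K < q)
    (hK : ((Finset.univ.filter fun x => d x ≤ 1 / 2).card : ℝ) ≤ K) {r : ℝ} (hr : 0 < r)
    (hr2 : r ≤ 1 / 2) :
    ((Finset.univ.filter fun x => d x ≤ r).card : ℝ) - 1 ≤ 4 * r * K := by
  have hpos : 0 < (Finset.univ.filter fun x => d x ≤ r).card :=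
    Finset.card_pos.mpr ⟨0, by simp [h0, hr.le]⟩
  set m := ⌊1 / (2 * r)⌋₊ with hm
  have h1 : (m : ℝ) ≤ 1 / (2 * r) := Nat.floor_le (by positivity)
  have h2 : 1 / (2 * r) < m + 1 := Nat.lt_floor_add_one _
  have h3 : 1 ≤ m := by
    rw [hm, Nat.one_le_floor_iff, le_div_iff₀ (by positivity)]
    linarith
  rw [le_div_iff₀ (by positivity)] at h1
  rw [div_lt_iff₀ (by positivity)] at h2
  have h3' : (1 : ℝ) ≤ m := by exact_mod_cast h3
  have h4 := ZMod.card_level_mul d h0 hadd hr.le m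
  have h5 : (Finset.univ.filter fun x => d x ≤ m * r).card ≤
      (Finset.univ.filter fun x => d x ≤ 1 / 2).card := by
    refine Finset.card_le_card fun x hx => ?_
    simp only [Finset.mem_filter, Finset.mem_univ, true_and] at hx ⊢
    linarith
  have h6 : (Finset.univ.filter fun x => d x ≤ 1 / 2).card < q := by
    exact_mod_cast hK.trans_lt hKq
  have h7 : m * ((Finset.univ.filter fun x => d x ≤ r).card - 1) + 1 ≤
      (Finset.univ.filter fun x => d x ≤ 1 / 2).card := by omega
  have h8 : (m : ℝ) * (((Finset.univ.filter fun x => d x ≤ r).card : ℝ) - 1) + 1 ≤ K := by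
    refine le_trans ?_ hK
    have := (Nat.cast_le (α := ℝ)).mpr h7
    rw [Nat.cast_add, Nat.cast_mul, Nat.cast_sub hpos] at this
    simpa using this
  have h9 : (1 : ℝ) ≤ (Finset.univ.filter fun x => d x ≤ r).card := by exact_mod_cast hpos
  have h10 : 1 ≤ 4 * r * m := by nlinarith
  nlinarith [mul_nonneg (sub_nonneg.mpr h10) (sub_nonneg.mpr h9)]

lemma Real.exp_neg_sq_div_two_mul_le (j : ℕ) :
    Real.exp (-(j : ℝ) ^ 2 / 2) * (j + 1) ≤ 8 * (1 / 2) ^ j := by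
  have h1 : (j : ℝ) + 1 ≤ Real.exp j := Real.add_one_le_exp _
  have h2 : (2 : ℝ) ^ j ≤ Real.exp j := by
    have : (2 : ℝ) ≤ Real.exp 1 := by linarith [Real.add_one_le_exp 1]
    calc (2 : ℝ) ^ j ≤ Real.exp 1 ^ j := by gcongr
      _ = Real.exp j := by rw [← Real.exp_nat_mul, mul_one]
  have h3 : Real.exp 2 ≤ 8 := by
    have : Real.exp 2 = Real.exp 1 * Real.exp 1 := by rw [← Real.exp_add]; norm_num
    rw [this]
    nlinarith [Real.exp_one_lt_d9, Real.exp_pos 1]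
  rw [one_div, inv_pow, ← div_eq_mul_inv, le_div_iff₀ (by positivity)]
  calc Real.exp (-(j : ℝ) ^ 2 / 2) * (j + 1) * 2 ^ j
      ≤ Real.exp (-(j : ℝ) ^ 2 / 2) * Real.exp j * Real.exp j := by gcongr
    _ = Real.exp (-(j : ℝ) ^ 2 / 2 + j + j) := by rw [Real.exp_add, Real.exp_add]
    _ ≤ Real.exp 2 := by
        rw [Real.exp_le_exp]
        nlinarith [sq_nonneg ((j : ℝ) - 2)]
    _ ≤ 8 := h3

/-- Slice by `j = ⌊d x * √L⌋₊`: the level bound grows linearly in `j` against Gaussian decay. Zero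
is split off to match the `- 1` in `ZMod.card_level_le`. -/
lemma ZMod.sum_exp_neg_sq_le {q : ℕ} [Fact q.Prime] (d : ZMod q → ℝ) (h0 : d 0 = 0)
    (hnn : ∀ x, 0 ≤ d x) (hadd : ∀ x y, d (x + y) ≤ d x + d y) {K : ℝ} (hKq : K < q)
    (hK : ((Finset.univ.filter fun x => d x ≤ 1 / 2).card : ℝ) ≤ K) {L : ℝ} (hL : 0 < L) :
    ∑ x ∈ Finset.univ.filter (fun x => d x ≤ 1 / 2), Real.exp (-(L * d x ^ 2) / 2) ≤
      1 + 64 * K / √L := by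
  classical
  have hK0 : 0 ≤ K := le_trans (by positivity) hK
  have hsL : 0 < √L := Real.sqrt_pos.mpr hL
  set S := (Finset.univ.filter fun x => d x ≤ 1 / 2).erase 0 with hS
  have hmem : (0 : ZMod q) ∈ Finset.univ.filter fun x => d x ≤ 1 / 2 := by simp [h0]
  rw [← Finset.add_sum_erase _ _ hmem, h0]
  have e1 : Real.exp (-(L * (0 : ℝ) ^ 2) / 2) = 1 := by simp
  rw [e1]
  gcongr
  rw [← hS]
  have hmaps : ∀ x ∈ S, ⌊d x * √L⌋₊ ∈ Finset.range (⌊√L⌋₊ + 1) := by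
    intro x hx
    rw [Finset.mem_range, Nat.lt_succ_iff]
    apply Nat.floor_le_floor
    have : d x ≤ 1 / 2 := by simpa using (Finset.mem_erase.mp hx).2
    nlinarith
  rw [← Finset.sum_fiberwise_of_maps_to hmaps]
  have hfib : ∀ j ∈ Finset.range (⌊√L⌋₊ + 1),
      ∑ x ∈ S.filter (fun x => ⌊d x * √L⌋₊ = j), Real.exp (-(L * d x ^ 2) / 2) ≤
        32 * K / √L * (1 / 2) ^ j := by
    intro j _
    have hval : ∀ x ∈ S.filter (fun x => ⌊d x * √L⌋₊ = j),
        Real.exp (-(L * d x ^ 2) / 2) ≤ Real.exp (-(j : ℝ) ^ 2 / 2) := by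
      intro x hx
      rw [Real.exp_le_exp]
      have h1 : (j : ℝ) ≤ d x * √L := by
        rw [← (Finset.mem_filter.mp hx).2]
        exact Nat.floor_le (mul_nonneg (hnn x) hsL.le)
      have h2 : (d x * √L) ^ 2 = L * d x ^ 2 := by rw [mul_pow, Real.sq_sqrt hL.le]; ring
      have h3 : (j : ℝ) ^ 2 ≤ (d x * √L) ^ 2 := by gcongr
      linarith
    have hcard : ((S.filter (fun x => ⌊d x * √L⌋₊ = j)).card : ℝ) ≤ 4 * ((j + 1) / √L) * K := by
      -- The cap `1 / 2` is needed by `ZMod.card_level_le` and loses nothing on `S`.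
      set r := min (((j : ℝ) + 1) / √L) (1 / 2) with hr
      have hr0 : 0 < r := lt_min (by positivity) (by norm_num)
      have hsub : S.filter (fun x => ⌊d x * √L⌋₊ = j) ⊆
          (Finset.univ.filter fun x => d x ≤ r).erase 0 := by
        intro x hx
        obtain ⟨hx1, hx2⟩ := Finset.mem_filter.mp hx
        obtain ⟨hx3, hx4⟩ := Finset.mem_erase.mp hx1
        refine Finset.mem_erase.mpr ⟨hx3, ?_⟩
        simp only [Finset.mem_filter, Finset.mem_univ, true_and] at hx4 ⊢
        refine le_min ?_ hx4
        rw [le_div_iff₀ hsL, ← hx2]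
        exact (Nat.lt_floor_add_one _).le
      have h0r : (0 : ZMod q) ∈ Finset.univ.filter fun x => d x ≤ r := by simp [h0, hr0.le]
      have h1 := (Nat.cast_le (α := ℝ)).mpr (Finset.card_le_card hsub)
      rw [Finset.cast_card_erase_of_mem h0r] at h1
      refine h1.trans ((ZMod.card_level_le d h0 hadd hKq hK hr0 (min_le_right _ _)).trans ?_)
      gcongr
      exact min_le_left _ _
    calc _ ≤ ((S.filter (fun x => ⌊d x * √L⌋₊ = j)).card : ℝ) * Real.exp (-(j : ℝ) ^ 2 / 2) := by
          rw [← nsmul_eq_mul]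
          exact Finset.sum_le_card_nsmul _ _ _ hval
      _ ≤ 4 * ((j + 1) / √L) * K * Real.exp (-(j : ℝ) ^ 2 / 2) := by gcongr
      _ = 4 * K / √L * (Real.exp (-(j : ℝ) ^ 2 / 2) * (j + 1)) := by ring
      _ ≤ 4 * K / √L * (8 * (1 / 2) ^ j) := by
          exact mul_le_mul_of_nonneg_left (Real.exp_neg_sq_div_two_mul_le j) (by positivity)
      _ = _ := by ring
  refine (Finset.sum_le_sum hfib).trans ?_
  rw [← Finset.mul_sum]
  have hgeo : ∑ j ∈ Finset.range (⌊√L⌋₊ + 1), (1 / 2 : ℝ) ^ j ≤ 2 := sum_geometric_two_le _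
  calc _ ≤ 32 * K / √L * 2 := by gcongr
    _ = _ := by ring

lemma Real.sqrt_sum_add_sq_le {ι : Type*} (s : Finset ι) (f g : ι → ℝ) :
    √(∑ i ∈ s, (f i + g i) ^ 2) ≤ √(∑ i ∈ s, f i ^ 2) + √(∑ i ∈ s, g i ^ 2) := by
  have hf : 0 ≤ ∑ i ∈ s, f i ^ 2 := Finset.sum_nonneg fun i _ => sq_nonneg _
  have hg : 0 ≤ ∑ i ∈ s, g i ^ 2 := Finset.sum_nonneg fun i _ => sq_nonneg _
  refine Real.sqrt_le_iff.mpr ⟨by positivity, ?_⟩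
  have h := Real.sum_mul_le_sqrt_mul_sqrt s f g
  have e : ∑ i ∈ s, (f i + g i) ^ 2 =
      ∑ i ∈ s, f i ^ 2 + 2 * ∑ i ∈ s, f i * g i + ∑ i ∈ s, g i ^ 2 := by
    rw [Finset.mul_sum, ← Finset.sum_add_distrib, ← Finset.sum_add_distrib]
    exact Finset.sum_congr rfl fun i _ => by ring
  rw [e, add_sq, Real.sq_sqrt hf, Real.sq_sqrt hg]
  linarith

/-! ### Fourier analysis on `ZMod q` -/

namespace ZMod

variable {q : ℕ} [NeZero q]

/-- The exponential sum over a finite subset of `ZMod q`. -/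
noncomputable def expSum (A : Finset (ZMod q)) (ξ : ZMod q) : ℂ := ∑ a ∈ A, stdAddChar (a * ξ)

lemma sum_stdAddChar_mul (b : ZMod q) :
    ∑ ξ : ZMod q, stdAddChar (b * ξ) = if b = 0 then (q : ℂ) else 0 := by
  have h := AddChar.sum_mulShift (R' := ℂ) b (isPrimitive_stdAddChar q)
  rw [ZMod.card] at h
  simp_rw [mul_comm b]
  rw [h]
  split_ifs <;> simp

lemma expSum_pow (A : Finset (ZMod q)) (m : ℕ) (ξ : ZMod q) :
    expSum A ξ ^ m =
      ∑ f ∈ Fintype.piFinset fun _ : Fin m => A, stdAddChar ((∑ i, f i) * ξ) := by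
  rw [expSum, Finset.sum_pow']
  refine Finset.sum_congr rfl fun f _ => ?_
  rw [Finset.sum_mul]
  exact (map_prod stdAddChar.toMonoidHom (fun i => Multiplicative.ofAdd (f i * ξ)) _).symm

lemma card_mul_sumCount (A : Finset (ZMod q)) (m : ℕ) (x : ZMod q) :
    (q : ℂ) * sumCount A m x = ∑ ξ : ZMod q, expSum A ξ ^ m * stdAddChar (-(x * ξ)) := by
  rw [Finset.sum_congr rfl fun ξ _ => by rw [expSum_pow, Finset.sum_mul], Finset.sum_comm]
  have : ∀ f ∈ Fintype.piFinset fun _ : Fin m => A,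
      ∑ ξ : ZMod q, stdAddChar ((∑ i, f i) * ξ) * stdAddChar (-(x * ξ)) =
        if ∑ i, f i = x then (q : ℂ) else 0 := by
    intro f _
    simp_rw [← AddChar.map_add_eq_mul, ← sub_eq_add_neg, ← sub_mul]
    rw [sum_stdAddChar_mul]
    simp only [sub_eq_zero]
  rw [Finset.sum_congr rfl this, ← Finset.sum_filter, Finset.sum_const, nsmul_eq_mul, mul_comm,
    sumCount]

lemma norm_stdAddChar (x : ZMod q) : ‖stdAddChar x‖ = 1 := by
  rw [stdAddChar_apply]; exact Circle.norm_coe _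

lemma card_mul_sumCount_le (A : Finset (ZMod q)) (m : ℕ) (x : ZMod q) :
    (q : ℝ) * sumCount A m x ≤ ∑ ξ : ZMod q, ‖expSum A ξ‖ ^ m := by
  have h := congrArg norm (card_mul_sumCount A m x)
  rw [norm_mul, Complex.norm_natCast, Complex.norm_natCast] at h
  rw [h]
  refine (norm_sum_le _ _).trans (Finset.sum_le_sum fun ξ _ => ?_)
  rw [norm_mul, norm_pow, norm_stdAddChar, mul_one]

lemma sq_norm_expSum (A : Finset (ZMod q)) (ξ : ZMod q) :
    ((‖expSum A ξ‖ ^ 2 : ℝ) : ℂ) = ∑ p ∈ A ×ˢ A, stdAddChar ((p.1 - p.2) * ξ) := by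
  have h : ((‖expSum A ξ‖ ^ 2 : ℝ) : ℂ) = expSum A ξ * (starRingEnd ℂ) (expSum A ξ) := by
    rw [Complex.mul_conj, Complex.normSq_eq_norm_sq]
  rw [h, expSum, map_sum, Finset.sum_mul_sum, ← Finset.sum_product']
  refine Finset.sum_congr rfl fun p _ => ?_
  rw [← AddChar.map_neg_eq_conj, ← AddChar.map_add_eq_mul]
  congr 1
  ring

lemma sum_sq_norm_expSum (A : Finset (ZMod q)) :
    ∑ ξ : ZMod q, ‖expSum A ξ‖ ^ 2 = q * A.card := by
  have h : ((∑ ξ : ZMod q, ‖expSum A ξ‖ ^ 2 : ℝ) : ℂ) = ((q * A.card : ℝ) : ℂ) := by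
    rw [Complex.ofReal_sum]
    simp_rw [sq_norm_expSum]
    rw [Finset.sum_comm]
    simp_rw [sum_stdAddChar_mul, sub_eq_zero]
    rw [Finset.sum_product]
    simp [mul_comm]
  exact_mod_cast h

/-- The `L²` distance from `1` of the characters `ξ ↦ stdAddChar ((a - b) * ξ)`, `a, b ∈ A`. -/
noncomputable def charDist (A : Finset (ZMod q)) (ξ : ZMod q) : ℝ :=
  √(∑ p ∈ A ×ˢ A, ‖stdAddChar ((p.1 - p.2) * ξ) - 1‖ ^ 2)

lemma charDist_zero (A : Finset (ZMod q)) : charDist A 0 = 0 := by simp [charDist]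

lemma charDist_add_le (A : Finset (ZMod q)) (ξ η : ZMod q) :
    charDist A (ξ + η) ≤ charDist A ξ + charDist A η := by
  refine le_trans (Real.sqrt_le_sqrt (Finset.sum_le_sum fun p _ => ?_))
    (Real.sqrt_sum_add_sq_le _ _ _)
  gcongr
  rw [mul_add, AddChar.map_add_eq_mul]
  set z : ℂ := stdAddChar ((p.1 - p.2) * ξ)
  set w : ℂ := stdAddChar ((p.1 - p.2) * η)
  have hz1 : ‖z‖ = 1 := norm_stdAddChar _
  calc ‖z * w - 1‖ = ‖(z - 1) + z * (w - 1)‖ := by congr 1; ring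
    _ ≤ ‖z - 1‖ + ‖z * (w - 1)‖ := norm_add_le _ _
    _ = ‖z - 1‖ + ‖w - 1‖ := by rw [norm_mul, hz1, one_mul]

/-- Sum `‖z - 1‖² = 2 - 2 Re z` over pairs. This ties large exponential sums to a subadditive
function. -/
lemma sq_charDist (A : Finset (ZMod q)) (ξ : ZMod q) :
    charDist A ξ ^ 2 = 2 * ((A.card : ℝ) ^ 2 - ‖expSum A ξ‖ ^ 2) := by
  rw [charDist, Real.sq_sqrt (Finset.sum_nonneg fun i _ => sq_nonneg _)]
  have h1 : ∀ z : ℂ, ‖z‖ = 1 → ‖z - 1‖ ^ 2 = 2 - 2 * z.re := by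
    intro z hz
    rw [← Complex.normSq_eq_norm_sq, Complex.normSq_sub, Complex.normSq_eq_norm_sq, hz]
    simp
    ring
  have h2 : ‖expSum A ξ‖ ^ 2 = ∑ p ∈ A ×ˢ A, (stdAddChar ((p.1 - p.2) * ξ) : ℂ).re := by
    have := congrArg Complex.re (sq_norm_expSum A ξ)
    rwa [Complex.ofReal_re, Complex.re_sum] at this
  rw [Finset.sum_congr rfl fun p _ => h1 _ (norm_stdAddChar _), Finset.sum_sub_distrib,
    ← Finset.mul_sum, ← h2]
  simp
  ring

end ZMod

/-! ### The bound modulo a prime, and assembly -/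

lemma ZMod.sumCount_le {q : ℕ} [Fact q.Prime] (A : Finset (ZMod q)) (hA : 2 ≤ A.card) (m : ℕ)
    (hm : 1 ≤ m) (x : ZMod q) :
    (sumCount A m x : ℝ) ≤
      (A.card : ℝ) ^ m * (1 / q + 100 / (A.card * √(m : ℝ))) := by
  have hq : (0 : ℝ) < q := by exact_mod_cast (Fact.out : q.Prime).pos
  have hn : (2 : ℝ) ≤ A.card := by exact_mod_cast hA
  set n : ℝ := (A.card : ℝ) with hndef
  have hn0 : 0 < n := by linarith
  have hm0 : (1 : ℝ) ≤ m := by exact_mod_cast hm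
  have hsm : 0 < √(m : ℝ) := Real.sqrt_pos.mpr (by linarith)
  -- `m = 1` is trivial; the large-`d` range below needs two spare factors of `ψ` for Parseval.
  rcases hm.eq_or_lt with rfl | hm2
  · have h1 : (sumCount A 1 x : ℝ) ≤ 1 := by exact_mod_cast sumCount_one_le A x
    simp only [Nat.cast_one, Real.sqrt_one, mul_one, pow_one]
    have : n * (1 / q + 100 / n) = n / q + 100 := by field_simp
    rw [this]
    have : 0 < n / q := by positivity
    linarith
  set ψ : ZMod q → ℝ := fun ξ => ‖expSum A ξ‖ / n with hψ
  set d : ZMod q → ℝ := fun ξ => charDist A ξ / (√2 * n) with hd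
  have hψ0 : ∀ ξ, 0 ≤ ψ ξ := fun ξ => by positivity
  have hd0 : ∀ ξ, 0 ≤ d ξ := fun ξ => div_nonneg (Real.sqrt_nonneg _) (by positivity)
  have hsq : ∀ ξ, ψ ξ ^ 2 = 1 - d ξ ^ 2 := by
    intro ξ
    simp only [hψ, hd, div_pow, mul_pow, sq_charDist]
    rw [Real.sq_sqrt (by norm_num), ← hndef]
    field_simp
    ring
  have hexp : ∀ ξ (c : ℕ), ψ ξ ^ c ≤ Real.exp (-(c * d ξ ^ 2) / 2) := by
    intro ξ c
    have h1 : ψ ξ ≤ Real.exp (-(d ξ ^ 2) / 2) := by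
      refine (sq_le_sq₀ (hψ0 ξ) (Real.exp_pos _).le).mp ?_
      rw [hsq, ← Real.exp_nat_mul]
      have := Real.one_sub_le_exp_neg (d ξ ^ 2)
      refine this.trans (Real.exp_le_exp.mpr (le_of_eq ?_))
      push_cast; ring
    calc ψ ξ ^ c ≤ Real.exp (-(d ξ ^ 2) / 2) ^ c := pow_le_pow_left₀ (hψ0 ξ) h1 c
      _ = _ := by rw [← Real.exp_nat_mul]; congr 1; ring
  have hpars : ∑ ξ, ψ ξ ^ 2 = q / n := by
    simp only [hψ, div_pow]
    rw [← Finset.sum_div, sum_sq_norm_expSum, ← hndef]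
    field_simp
  -- On `{d ≤ 1/2}` we have `ψ² ≥ 3/4`, so Parseval gives `(4/3) * (q / n)`; `n ≥ 2` makes this less
  -- than `q`.
  set K : ℝ := 4 * q / (3 * n) with hKdef
  have hKq : K < q := by
    rw [hKdef, div_lt_iff₀ (by positivity)]
    nlinarith
  have hK : ((Finset.univ.filter fun ξ => d ξ ≤ 1 / 2).card : ℝ) ≤ K := by
    have h1 : ((Finset.univ.filter fun ξ => d ξ ≤ 1 / 2).card : ℝ) * (3 / 4) ≤ q / n := by
      rw [← hpars, ← nsmul_eq_mul]
      refine (Finset.card_nsmul_le_sum _ (fun ξ => ψ ξ ^ 2) _ fun ξ hξ => ?_).trans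
        (Finset.sum_le_sum_of_subset_of_nonneg (Finset.subset_univ _) fun _ _ _ => sq_nonneg _)
      have h2 : d ξ ≤ 1 / 2 := by simpa using hξ
      rw [hsq]
      nlinarith [hd0 ξ]
    have e : K = (q / n) * (4 / 3) := by rw [hKdef]; field_simp
    rw [e]
    linarith
  have hmain := ZMod.sum_exp_neg_sq_le d (by simp [hd, charDist_zero]) hd0
    (fun ξ η => by
      simp only [hd]
      rw [← add_div]
      gcongr
      exact charDist_add_le A ξ η) hKq hK (L := m) (by linarith)
  have hlow : ∑ ξ ∈ Finset.univ.filter (fun ξ => d ξ ≤ 1 / 2), ψ ξ ^ m ≤ 1 + 64 * K / √(m : ℝ) :=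
    (Finset.sum_le_sum fun ξ _ => hexp ξ m).trans hmain
  have hhigh : ∑ ξ ∈ Finset.univ.filter (fun ξ => ¬ d ξ ≤ 1 / 2), ψ ξ ^ m ≤
      8 / √(m : ℝ) * (q / n) := by
    rw [← hpars, Finset.mul_sum]
    refine (Finset.sum_le_sum fun ξ hξ => ?_).trans
      (Finset.sum_le_sum_of_subset_of_nonneg (Finset.subset_univ _)
        fun _ _ _ => by positivity)
    have h2 : 1 / 2 < d ξ := by simpa using hξ
    obtain ⟨c, rfl⟩ : ∃ c, m = c + 2 := ⟨m - 2, by omega⟩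
    rw [pow_add]
    gcongr
    refine (hexp ξ c).trans ?_
    have h3 : Real.exp (-(c * d ξ ^ 2) / 2) ≤ Real.exp (-(c / 8 : ℝ)) := by
      rw [Real.exp_le_exp]
      have : (1 : ℝ) / 4 ≤ d ξ ^ 2 := by nlinarith
      nlinarith [mul_le_mul_of_nonneg_left this (Nat.cast_nonneg (α := ℝ) c)]
    refine h3.trans ?_
    rw [Real.exp_neg, le_div_iff₀ hsm, inv_mul_le_iff₀ (Real.exp_pos _)]
    have h4 := Real.add_one_le_exp (c / 8 : ℝ)
    have h5 : √((c + 2 : ℕ) : ℝ) ≤ (c + 2 : ℕ) := by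
      rw [Real.sqrt_le_left (by positivity)]
      nlinarith
    push_cast at h5 ⊢
    linarith
  have htot : ∑ ξ, ψ ξ ^ m ≤ 1 + 100 * (q / n) / √(m : ℝ) := by
    rw [← Finset.sum_filter_add_sum_filter_not _ (fun ξ => d ξ ≤ 1 / 2)]
    refine (add_le_add hlow hhigh).trans ?_
    have e : 64 * K / √(m : ℝ) + 8 / √(m : ℝ) * (q / n) =
        (280 / 3) * (q / n) / √(m : ℝ) := by rw [hKdef]; field_simp; ring
    rw [add_assoc, e]
    gcongr
    norm_num
  have hfin := card_mul_sumCount_le A m x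
  have e : ∑ ξ, ‖expSum A ξ‖ ^ m = n ^ m * ∑ ξ, ψ ξ ^ m := by
    rw [Finset.mul_sum]
    refine Finset.sum_congr rfl fun ξ _ => ?_
    simp only [hψ]
    rw [div_pow]
    field_simp
  rw [e] at hfin
  refine le_of_mul_le_mul_left ?_ hq
  calc (q : ℝ) * sumCount A m x ≤ n ^ m * ∑ ξ, ψ ξ ^ m := hfin
    _ ≤ n ^ m * (1 + 100 * (q / n) / √(m : ℝ)) := by gcongr
    _ = q * (n ^ m * (1 / q + 100 / (n * √(m : ℝ)))) := by field_simp

lemma ZMod.sumCount_le_of_lt_minFac (k n m : ℕ) (hk : 1 < k) (A : Finset (ZMod k))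
    (hA : A.card = n) (hm : 1 ≤ m) (hmn : 2 * m ≤ n) (hp : n ^ n < k.minFac) (x : ZMod k) :
    (sumCount A m x : ℝ) ≤ (n : ℝ) ^ m * (101 / (n * √(m : ℝ))) := by
  -- `2 * k` serves rectification; `n * m` absorbs the zero frequency's `1 / q`.
  obtain ⟨q, hq, hprime⟩ := Nat.exists_infinite_primes (2 * k + n * m)
  obtain ⟨B, y, hB, hle⟩ := exists_sumCount_le_prime k n m hk A hA hm hmn hp q (by omega) x
  have : Fact q.Prime := ⟨hprime⟩
  have h := ZMod.sumCount_le B (by omega) m hm y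
  rw [hB] at h
  have hn0 : (0 : ℝ) < n := by exact_mod_cast (by omega : 0 < n)
  have hm0 : (1 : ℝ) ≤ m := by exact_mod_cast hm
  have hsm : 0 < √(m : ℝ) := Real.sqrt_pos.mpr (by linarith)
  have h1 : (1 : ℝ) / q ≤ 1 / (n * √(m : ℝ)) := by
    have h2 : (n * m : ℝ) ≤ q := by exact_mod_cast (by omega : n * m ≤ q)
    have h3 : √(m : ℝ) ≤ m := by
      rw [Real.sqrt_le_left (by positivity)]
      nlinarith
    gcongr
    exact le_trans (by gcongr) h2
  calc (sumCount A m x : ℝ) ≤ sumCount B m y := by exact_mod_cast hle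
    _ ≤ (n : ℝ) ^ m * (1 / q + 100 / (n * √(m : ℝ))) := h
    _ ≤ (n : ℝ) ^ m * (1 / (n * √(m : ℝ)) + 100 / (n * √(m : ℝ))) := by gcongr
    _ = _ := by rw [← add_div]; norm_num

theorem mainTheorem7 :
    ∃ D : ℝ, ∀ (k : ℕ) [NeZero k] (A : Finset (ZMod k)) (n l : ℕ),
      A.card = n →
      (∀ q : ℕ, q.Prime → q ∣ k → n ^ n < q) →
      2 ≤ l → l ≤ n →
      ∀ (Ω : Type*) [MeasurableSpace Ω] (P : Measure Ω) [IsProbabilityMeasure P]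
        (Y : Fin l → Ω → ZMod k),
        (∀ i, HasLaw (Y i) (uniformOn (A : Set (ZMod k))) P) →
        iIndepFun Y P →
        ∀ x : ZMod k,
          P.real {ω | ∑ i, Y i ω = x} ≤ D / ((n : ℝ) * √((l : ℝ) - 1)) := by
  refine ⟨202, ?_⟩
  intro k _ A n l hA hp hl hln Ω _ P _ Y hY hI x
  have hk : 1 < k := by
    have h1 := Finset.card_le_univ A
    rw [ZMod.card] at h1
    omega
  -- Halving meets the rectification condition `2 * m ≤ n` and costs only a constant, since `l - 1 ≤
  -- 2 * m`.
  set m := l / 2 with hmdef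
  obtain ⟨j, hj⟩ : ∃ j, l = m + j := ⟨l - m, by omega⟩
  have hm : 1 ≤ m := by omega
  have hcount := sumCount_add_le A m (ZMod.sumCount_le_of_lt_minFac k n m hk A hA hm (by omega)
    (hp _ (Nat.minFac_prime (by omega)) (Nat.minFac_dvd k))) j x
  rw [← hj, hA, ← mul_assoc, ← pow_add, add_comm j m, ← hj] at hcount
  have hn0 : (0 : ℝ) < n := by exact_mod_cast (by omega : 0 < n)
  have hm0 : (1 : ℝ) ≤ m := by exact_mod_cast hm
  have hsm : 0 < √(m : ℝ) := Real.sqrt_pos.mpr (by linarith)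
  have hl0 : (0 : ℝ) < (l : ℝ) - 1 := by
    have : (2 : ℝ) ≤ l := by exact_mod_cast hl
    linarith
  have hsl : 0 < √((l : ℝ) - 1) := Real.sqrt_pos.mpr hl0
  have hroot : √((l : ℝ) - 1) ≤ 2 * √(m : ℝ) := by
    have h1 : (l : ℝ) ≤ 2 * m + 1 := by exact_mod_cast (by omega : l ≤ 2 * m + 1)
    rw [Real.sqrt_le_left (by positivity), mul_pow, Real.sq_sqrt (by positivity)]
    linarith
  calc P.real {ω | ∑ i, Y i ω = x} ≤ sumCount A l x / (A.card : ℝ) ^ l :=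
        measureReal_sum_eq_le_sumCount A l P Y hY hI x
    _ ≤ 101 / (n * √(m : ℝ)) := by
        rw [hA, div_le_iff₀ (by positivity), mul_comm]
        exact hcount
    _ ≤ 202 / ((n : ℝ) * √((l : ℝ) - 1)) := by
        rw [div_le_div_iff₀ (by positivity) (by positivity)]
        nlinarith [mul_le_mul_of_nonneg_left hroot hn0.le]
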